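/- Fix $n,m,k,q,N,M$ with $N\ge 1$, a tolerance $\epsilon\in(0,1)$, a radius $r\ge 0$, and $\mathbf C\in\mathbb R^{q\times k}$, $\mathbf d\in\mathbb R^q$ such that the polyhedron $\Xi=\{\xi\in\mathbb R^k : \mathbf C\xi\le \mathbf d\}$ is compact; equip $\Xi$ with the Euclidean metric. Let $\xi_1,\dots,\xi_N\in\Xi$, let $\hat{\mathbb P}_N=\frac1N\sum_{i=1}^N\delta_{\xi_i}$, and let $\mathcal M_N^r$ be the set of Borel probability measures $\mathbb P$ on $\Xi$ with finite first moment and $W_1(\mathbb P,\hat{\mathbb P}_N)\le r$, where $W_1$ is the $1$-Wasserstein distance. Let $\underline{\mathcal U}=\{1\}\times\mathbb R^m$, let $\mathbf x\in\mathbb R^n$ be a state, $\underline{\mathbf k}(\mathbf x)\in\mathbb R^{m+1}$ a baseline control, and for $l\in[M]=\{1,\dots,M\}$ let $$G_l(\mathbf x,\mathbf u,\xi)=\mathbf u^\top \mathbf q_l(\mathbf x)+\mathbf u^\top \mathbf R_l(\mathbf x)\,\xi+\alpha_l(J_l(\mathbf x)),$$ with $\mathbf q_l(\mathbf x)\in\mathbb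 R^{m+1}$, $\mathbf R_l(\mathbf x)\in\mathbb R^{(m+1)\times k}$, $\alpha_l:\mathbb R\to\mathbb R$, $J_l:\mathbb R^n\to\mathbb R$. Write $(w)_+=\max(w,0)$ and let $\|\cdot\|$ be the Euclidean norm. Consider the worst-case CVaR problem $$\text{(P)}\quad \min_{\mathbf u\in\underline{\mathcal U}}\ \|\mathbf u-\underline{\mathbf k}(\mathbf x)\|^2\quad\text{s.t.}\quad \sup_{\mathbb P\in\mathcal M_N^r}\ \inf_{t\in\mathbb R}\big[\epsilon^{-1}\mathbb E_{\mathbb P}[(G_l(\mathbf x,\mathbf u,\xi)+t)_+]-t\big]\le 0\quad\forall l\in[M],$$ and the program (S) that minimizes $y$ over $\mathbf u\in\underline{\mathcal U}$, $y\in\mathbb R$ and $t_l\in\mathbb R$, $s_l(i)\in\mathbb R$, $\beta_l\in\mathbb R_{\ge 0}$, $\eta_{l,i}\in\mathbb R^q$ ($l\in[M]$, $i\in[N]$) subject to, for all $l\in[M]$ and $i\in[N]$, $$\beta_l r+\tfrac1N\sum_{j=1}^N s_l(j)-t_l\epsilon\le 0,\qquad s_l(i)\ge 0,\qquad \eta_{l,i}\ge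 \mathbf 0_q,$$ $$s_l(i)\ge \mathbf u^\top \mathbf q_l(\mathbf x)+t_l+(\mathbf u^\top \mathbf R_l(\mathbf x)-\eta_{l,i}^\top \mathbf C)\xi_i+\eta_{l,i}^\top \mathbf d+\alpha_l(J_l(\mathbf x)),$$ $$\|\mathbf u^\top \mathbf R_l(\mathbf x)-\eta_{l,i}^\top \mathbf C\|\le \beta_l,\qquad y+1\ge\sqrt{\|2(\mathbf u-\underline{\mathbf k}(\mathbf x))\|^2+(y-1)^2}.$$ Then (S) is a second-order cone program and it is equivalent to (P): for all $\mathbf u$ and $y$, $\mathbf u$ is feasible for (P) with $\|\mathbf u-\underline{\mathbf k}(\mathbf x)\|^2\le y$ if and only if $(\mathbf u,y)$ extends to a feasible point of (S); in particular the two programs have the same feasible controls $\mathbf u$. They have the same optimal value ($+\infty$ if infeasible) and the same optimal controls $\mathbf u$, and $y=\|\mathbf u-\underline{\mathbf k}(\mathbf x)\|^2$ at every optimal solution of (S). -/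

import Mathlib

open MeasureTheory
open scoped ENNReal Matrix

noncomputable section

namespace DRCCP

/-! ### Optimization problems -/

/-- A minimization problem `min { objective z | z ∈ feasible }` over a space `E`. -/
structure Program (E : Type*) where
  objective : E → ℝ
  feasible : Set E

namespace Program

variable {E : Type*}

/-- The optimal value, as an extended real number (`⊤` if the problem is infeasible). -/
def value (P : Program E) : EReal :=
  ⨅ z ∈ P.feasible, (P.objective z : EReal)

/-- `z` is an optimal solution. -/
def IsOptimal (P : Program E) (z : E) : Prop :=
  z ∈ P.feasible ∧ ∀ w ∈ P.feasible, P.objective z ≤ P.objective w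

/-- A second-order cone program: the objective is linear, and the feasible set is given by finitely
many constraints `‖A z + b‖ ≤ c z + e` with the Euclidean norm. (A linear inequality is such
a constraint with values of `A` in dimension `0`, and a linear equation is two of those.) -/
def IsSOCP [AddCommGroup E] [Module ℝ E] (P : Program E) : Prop :=
  (∃ c : E →ₗ[ℝ] ℝ, ∀ z, P.objective z = c z) ∧
  ∃ (ι : Type) (_ : Finite ι) (dim : ι → ℕ)
    (A : (j : ι) → E →ₗ[ℝ] EuclideanSpace ℝ (Fin (dim j)))
    (b : (j : ι) → EuclideanSpace ℝ (Fin (dim j)))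
    (c : ι → E →ₗ[ℝ] ℝ) (e : ι → ℝ),
    P.feasible = {z | ∀ j, ‖A j z + b j‖ ≤ c j z + e j}

end Program

/-! ### Wasserstein ambiguity sets and CVaR -/

section Wasserstein

variable {X : Type*} [MetricSpace X] [MeasurableSpace X]

/-- The couplings of `μ` and `ν`: measures on `X × X` with marginals `μ` and `ν`. -/
def couplings (μ ν : Measure X) : Set (Measure (X × X)) :=
  {γ | γ.map Prod.fst = μ ∧ γ.map Prod.snd = ν}

/-- The `p`-Wasserstein distance, with values in `[0, ∞]`. -/
def wasserstein (p : ℝ) (μ ν : Measure X) : ℝ≥0∞ :=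
  (⨅ γ ∈ couplings μ ν, ∫⁻ z, edist z.1 z.2 ^ p ∂γ) ^ (1 / p)

/-- The measures with finite `p`-th moment. -/
def HasFiniteMoment (p : ℝ) (μ : Measure X) : Prop :=
  ∃ x₀ : X, ∫⁻ x, edist x x₀ ^ p ∂μ < ∞

/-- The empirical distribution `(1/N) ∑ δ_{ξ i}`. -/
def empirical {N : ℕ} (ξ : Fin N → X) : Measure X :=
  (N : ℝ≥0∞)⁻¹ • ∑ i, Measure.dirac (ξ i)

/-- The ambiguity set: the probability measures with finite `p`-th moment at `p`-Wasserstein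
distance at most `r` from the empirical distribution. -/
def ambiguitySet {N : ℕ} (p : ℝ) (ξ : Fin N → X) (r : ℝ) : Set (Measure X) :=
  {μ | IsProbabilityMeasure μ ∧ HasFiniteMoment p μ ∧
    wasserstein p μ (empirical ξ) ≤ ENNReal.ofReal r}

/-- `CVaR_{1-ε}` of `Q` under `μ`, that is `inf_t (ε⁻¹ 𝔼[(Q + t)₊] - t)`, for integrable `Q`
(the infimum is taken in the extended reals). -/
def cvar (ε : ℝ) (μ : Measure X) (Q : X → ℝ) : EReal :=
  ⨅ t : ℝ, ((ε⁻¹ * ∫ x, max (Q x + t) 0 ∂μ - t : ℝ) : EReal)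

/-- The worst-case `CVaR_{1-ε}` of `Q` over the ambiguity set. -/
def worstCaseCVaR {N : ℕ} (p : ℝ) (ξ : Fin N → X) (r ε : ℝ) (Q : X → ℝ) : EReal :=
  ⨆ μ ∈ ambiguitySet p ξ r, cvar ε μ Q

end Wasserstein

/-! ### Control synthesis -/

/-- The polyhedron `{ξ ∈ ℝᵏ | C ξ ≤ d}`, with the Euclidean metric. -/
def polyhedron {q k : ℕ} (C : Matrix (Fin q) (Fin k) ℝ) (d : Fin q → ℝ) :
    Set (EuclideanSpace ℝ (Fin k)) :=
  {ξ | C *ᵥ ξ.ofLp ≤ d}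

/-- The set of control inputs `{1} × ℝᵐ`. -/
def controls (m : ℕ) : Set (EuclideanSpace ℝ (Fin (m + 1))) :=
  {u | u 0 = 1}

/-- The affine constraint function `uᵀ q + uᵀ R ξ + a`. -/
def affineG {m k : ℕ} (qv : EuclideanSpace ℝ (Fin (m + 1)))
    (R : Matrix (Fin (m + 1)) (Fin k) ℝ) (a : ℝ)
    (u : EuclideanSpace ℝ (Fin (m + 1))) (ξ : EuclideanSpace ℝ (Fin k)) : ℝ :=
  u.ofLp ⬝ᵥ qv.ofLp + (u.ofLp ᵥ* R) ⬝ᵥ ξ.ofLp + a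

/-- The control synthesis problem at one state, with worst-case CVaR constraints over the
`p`-Wasserstein ball of radius `r` around the empirical distribution of the samples `ξ` in `Ξ`:
minimize `‖u - κ‖²` over `u ∈ {1} × ℝᵐ` subject to
`sup_μ inf_t (ε⁻¹ 𝔼_μ[(G_l(u, ·) + t)₊] - t) ≤ 0` for all `l`. -/
def cvarProgram {m k N M : ℕ} (p : ℝ) (Ξ : Set (EuclideanSpace ℝ (Fin k))) (ξ : Fin N → Ξ)
    (r ε : ℝ) (κ : EuclideanSpace ℝ (Fin (m + 1)))
    (G : Fin M → EuclideanSpace ℝ (Fin (m + 1)) → EuclideanSpace ℝ (Fin k) → ℝ) :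
    Program (EuclideanSpace ℝ (Fin (m + 1))) where
  objective u := ‖u - κ‖ ^ 2
  feasible := {u | u ∈ controls m ∧
    ∀ l, worstCaseCVaR p ξ r ε (fun ζ : Ξ => G l u (ζ : EuclideanSpace ℝ (Fin k))) ≤ 0}

/-- The decision variables `(u, y, t, s, β, η)` of the reformulation: `u ∈ ℝ^{m+1}`, `y ∈ ℝ` and,
for each constraint `l`, `t l ∈ ℝ`, `s l i ∈ ℝ`, `β l ∈ ℝ`, `η l i ∈ ℝ^q`. -/
abbrev Decision (m N M q : ℕ) : Type :=
  EuclideanSpace ℝ (Fin (m + 1)) × ℝ × (Fin M → ℝ) × (Fin M → Fin N → ℝ) × (Fin M → ℝ) ×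
    (Fin M → Fin N → Fin q → ℝ)

/-- The constraints of the reformulation. -/
structure SocpConstraints {m k N M q : ℕ} (C : Matrix (Fin q) (Fin k) ℝ) (d : Fin q → ℝ)
    (ξ : Fin N → EuclideanSpace ℝ (Fin k)) (r ε : ℝ) (κ : EuclideanSpace ℝ (Fin (m + 1)))
    (qv : Fin M → EuclideanSpace ℝ (Fin (m + 1)))
    (R : Fin M → Matrix (Fin (m + 1)) (Fin k) ℝ) (a : Fin M → ℝ)
    (u : EuclideanSpace ℝ (Fin (m + 1))) (y : ℝ) (t : Fin M → ℝ) (s : Fin M → Fin N → ℝ)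
    (β : Fin M → ℝ) (η : Fin M → Fin N → Fin q → ℝ) : Prop where
  control : u ∈ controls m
  beta_nonneg : ∀ l, 0 ≤ β l
  budget : ∀ l, β l * r + (1 / (N : ℝ)) * ∑ i, s l i - t l * ε ≤ 0
  slack_nonneg : ∀ l i, 0 ≤ s l i
  slack : ∀ l i, u.ofLp ⬝ᵥ (qv l).ofLp + t l
      + (u.ofLp ᵥ* R l - η l i ᵥ* C) ⬝ᵥ (ξ i).ofLp + η l i ⬝ᵥ d + a l ≤ s l i
  cone : ∀ l i, ‖WithLp.toLp 2 (u.ofLp ᵥ* R l - η l i ᵥ* C)‖ ≤ β l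
  eta_nonneg : ∀ l i, 0 ≤ η l i
  epigraph : √(‖(2 : ℝ) • (u - κ)‖ ^ 2 + (y - 1) ^ 2) ≤ y + 1

/-- The reformulation: minimize `y` over `(u, y, t, s, β, η)` subject to `SocpConstraints`. -/
def socp {m k N M q : ℕ} (C : Matrix (Fin q) (Fin k) ℝ) (d : Fin q → ℝ)
    (ξ : Fin N → EuclideanSpace ℝ (Fin k)) (r ε : ℝ) (κ : EuclideanSpace ℝ (Fin (m + 1)))
    (qv : Fin M → EuclideanSpace ℝ (Fin (m + 1)))
    (R : Fin M → Matrix (Fin (m + 1)) (Fin k) ℝ) (a : Fin M → ℝ) :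
    Program (Decision m N M q) where
  objective := fun (_, y, _) => y
  feasible := {(u, y, t, s, β, η) | SocpConstraints C d ξ r ε κ qv R a u y t s β η}

end DRCCP

end

namespace DRCCP

/-! The equivalence rests on two dualities with attained multipliers, applied to each constraint
separately.

The first is in the space of measures: for Lipschitz `G` on a compact space, the worst-case CVaR is
at most zero iff there are `t`, `β ≥ 0` and `s ≥ 0` within the budget such that `G x + t - β * dist
x (ξ i) ≤ s i` everywhere (`worstCaseCVaR_le_zero_iff`). Sufficiency follows by integrating this
bound against nearly optimal couplings. For necessity with `r > 0`, no minimax theorem is invoked.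
The affine lower bounds in `t` of `𝔼 (G + t)₊ - t * ε`, paired with unused transport budget, form a
convex set in `ℝ³`; the hypothesis keeps it disjoint from an open convex cone, and a separating
plane yields `t` and `β`. The identity coupling leaves budget `r > 0`, which prevents the plane from
being vertical. For `r = 0` the term `β * r` vanishes, so a Lipschitz constant serves as `β`.

The second is in `ℝᵏ`: for affine `G`, the remaining bound over the polyhedron says that a linear
function minus `β` times a norm is bounded, and `exists_multiplier` converts this into `η`.
Separation gives attained multipliers because finitely generated cones are closed.

The cone constraint on `y` is just `‖u - κ‖ ^ 2 ≤ y`, so (S) projects onto the epigraph of (P); the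
statements on values and optimizers follow formally. -/

lemma sum_coe_eq_sum_of_forall_notMem {ι V : Type*} [Fintype ι] [AddCommMonoid V] (s : Set ι) [Fintype s] (f : ι → V)
    (h : ∀ i, i ∉ s → f i = 0) : ∑ i : s, f i = ∑ i, f i := by
  rw [Finset.sum_set_coe]
  exact Finset.sum_subset (Finset.subset_univ _) fun i _ hi => h i (by simpa using hi)

/-! ### Finitely generated cones and Lagrange duality over a polyhedron -/

section Cone

variable {ι V : Type*} [Fintype ι] [AddCommGroup V] [Module ℝ V]

/-- If the vectors in the support of nonnegative coefficients are linearly dependent, then some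
coefficient can be eliminated. -/
lemma exists_nonneg_coeff_support_ssubset (c : ι → V) (η : ι → ℝ) (hη : 0 ≤ η)
    (hdep : ¬ LinearIndepOn ℝ c (Function.support η)) :
    ∃ η' : ι → ℝ, 0 ≤ η' ∧ Function.support η' ⊂ Function.support η ∧
      ∑ i, η' i • c i = ∑ i, η i • c i := by
  classical
  obtain ⟨g, hgs, hg0, i₀, hi₀⟩ : ∃ g : ι → ℝ, (∀ i, η i = 0 → g i = 0) ∧
      ∑ i, g i • c i = 0 ∧ ∃ i, 0 < g i := by
    rw [LinearIndepOn, Fintype.linearIndependent_iff] at hdep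
    push Not at hdep
    obtain ⟨g, hg, i, hi⟩ := hdep
    let g' : ι → ℝ := fun j => if h : j ∈ Function.support η then g ⟨j, h⟩ else 0
    have hsum : ∑ j, g' j • c j = 0 := by
      rw [← hg, ← sum_coe_eq_sum_of_forall_notMem (Function.support η)]
      · exact Finset.sum_congr rfl fun j _ => by simp only [g', dif_pos j.2]
      · intro j hj
        simp only [g', dif_neg hj, zero_smul]
    have hs : ∀ j, η j = 0 → g' j = 0 := fun j hj => by simp [g', hj]
    have hi' : g' i ≠ 0 := by simpa only [g', dif_pos i.2] using hi
    rcases hi'.lt_or_gt with h | h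
    · refine ⟨-g', fun j hj => by simp [hs j hj], by simp [hsum], i, by simpa using h⟩
    · exact ⟨g', hs, hsum, i, h⟩
  -- Ratio test: moving from `η` along `-g`, the index `j` is the first coefficient to reach zero
  -- while all others are still nonnegative.
  obtain ⟨j, hj, hmin⟩ := Finset.exists_min_image (Finset.univ.filter fun i => 0 < g i)
    (fun i => η i / g i) ⟨i₀, by simpa using hi₀⟩
  simp only [Finset.mem_filter, Finset.mem_univ, true_and] at hj hmin
  have hθ : 0 ≤ η j / g j := div_nonneg (hη j) hj.le
  refine ⟨fun i => η i - η j / g j * g i, fun i => ?_, ?_, ?_⟩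
  · simp only [Pi.zero_apply, sub_nonneg]
    rcases le_or_gt (g i) 0 with h | h
    · exact (mul_nonpos_of_nonneg_of_nonpos hθ h).trans (hη i)
    · exact (le_div_iff₀ h).1 (hmin i h)
  · rw [Set.ssubset_iff_of_subset]
    · refine ⟨j, fun h => hj.ne' (hgs j h), ?_⟩
      simp [div_mul_cancel₀ _ hj.ne']
    · intro i hi h
      exact hi (by simp [h, hgs i h])
  · simp [sub_smul, mul_smul, ← Finset.smul_sum, hg0]

/-- Carathéodory's theorem for cones. -/
lemma exists_nonneg_coeff_linearIndepOn (c : ι → V) (η : ι → ℝ) (hη : 0 ≤ η) :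
    ∃ η' : ι → ℝ, 0 ≤ η' ∧ LinearIndepOn ℝ c (Function.support η') ∧
      ∑ i, η' i • c i = ∑ i, η i • c i := by
  induction h : (Function.support η).ncard using Nat.strong_induction_on generalizing η with
  | _ n ih =>
    by_cases hdep : LinearIndepOn ℝ c (Function.support η)
    · exact ⟨η, hη, hdep, rfl⟩
    · obtain ⟨η₁, h₁, hss, hsum⟩ := exists_nonneg_coeff_support_ssubset c η hη hdep
      obtain ⟨η₂, h₂, hind, hsum'⟩ :=
        ih _ (h ▸ Set.ncard_lt_ncard hss (Set.toFinite _)) η₁ h₁ rfl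
      exact ⟨η₂, h₂, hind, hsum'.trans hsum⟩

/-- A finitely generated cone is closed. -/
lemma isClosed_range_nonneg_coeff [TopologicalSpace V] [IsTopologicalAddGroup V]
    [ContinuousSMul ℝ V] [T2Space V] (c : ι → V) :
    IsClosed {v : V | ∃ η : ι → ℝ, 0 ≤ η ∧ ∑ i, η i • c i = v} := by
  classical
  -- By Carathéodory the cone is a finite union over linearly independent subfamilies. Each piece is
  -- the image of a closed orthant under an injective linear map, a closed embedding in finite
  -- dimension.
  have heq : {v : V | ∃ η : ι → ℝ, 0 ≤ η ∧ ∑ i, η i • c i = v} =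
      ⋃ s : {s : Set ι // LinearIndepOn ℝ c s},
        (Fintype.linearCombination ℝ fun i : s.1 => c i) '' Set.Ici 0 := by
    ext v
    simp only [Set.mem_ofPred_eq, Set.mem_iUnion, Set.mem_image, Set.mem_Ici,
      Fintype.linearCombination_apply]
    constructor
    · rintro ⟨η, hη, rfl⟩
      obtain ⟨η', h₁, h₂, h₃⟩ := exists_nonneg_coeff_linearIndepOn c η hη
      refine ⟨⟨_, h₂⟩, fun i => η' i, fun i => h₁ i, ?_⟩
      rw [← h₃]
      exact sum_coe_eq_sum_of_forall_notMem _ (fun i => η' i • c i) fun i hi => by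
        rw [Function.notMem_support.1 hi, zero_smul]
    · rintro ⟨s, η, hη, rfl⟩
      refine ⟨fun i => if h : i ∈ s.1 then η ⟨i, h⟩ else 0, fun i => ?_, ?_⟩
      · by_cases h : i ∈ s.1
        · simpa [h] using hη ⟨i, h⟩
        · simp [h]
      · rw [← sum_coe_eq_sum_of_forall_notMem s.1]
        · exact Finset.sum_congr rfl fun i _ => by simp
        · intro i hi
          simp [hi]
  rw [heq]
  refine isClosed_iUnion_of_finite fun s => ?_
  refine (LinearMap.isClosedEmbedding_of_injective ?_).isClosedMap _ isClosed_Ici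
  rw [LinearMap.ker_eq_bot]
  exact s.2.fintypeLinearCombination_injective

end Cone

/-- Lagrange duality over a polyhedron for the maximization of a linear function minus a multiple
of the distance to a feasible point, with attained multipliers. -/
lemma exists_multiplier {q k : ℕ} {C : Matrix (Fin q) (Fin k) ℝ} {d : Fin q → ℝ}
    {x₀ : EuclideanSpace ℝ (Fin k)} (hx₀ : x₀ ∈ polyhedron C d) (a : EuclideanSpace ℝ (Fin k))
    {β c : ℝ} (hβ : 0 ≤ β)
    (h : ∀ x ∈ polyhedron C d, inner ℝ a (x - x₀) - β * ‖x - x₀‖ ≤ c) :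
    ∃ η : Fin q → ℝ, 0 ≤ η ∧ ‖a - WithLp.toLp 2 (η ᵥ* C)‖ ≤ β ∧
      η ⬝ᵥ (d - C *ᵥ x₀.ofLp) ≤ c := by
  -- Each row of `C` is paired with its slack at `x₀`. The extra generator `(0, 1)` turns the bound
  -- `≤ c` into an equality, so a common point of `K` and `T` is exactly a multiplier.
  let gen : Option (Fin q) → EuclideanSpace ℝ (Fin k) × ℝ := fun o =>
    o.elim (0, 1) fun i => (WithLp.toLp 2 (C i), (d - C *ᵥ x₀.ofLp) i)
  set T : Set (EuclideanSpace ℝ (Fin k) × ℝ) := 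
    {v | ∃ η : Option (Fin q) → ℝ, 0 ≤ η ∧ ∑ i, η i • gen i = v} with hT
  set K : Set (EuclideanSpace ℝ (Fin k) × ℝ) := Metric.closedBall a β ×ˢ {c} with hK
  by_cases hdisj : Disjoint K T
  · exfalso
    have hTconv : Convex ℝ T := by
      rintro _ ⟨η₁, h₁, rfl⟩ _ ⟨η₂, h₂, rfl⟩ s t hs ht -
      refine ⟨s • η₁ + t • η₂, add_nonneg (smul_nonneg hs h₁) (smul_nonneg ht h₂), ?_⟩
      simp [add_smul, mul_smul, Finset.sum_add_distrib, Finset.smul_sum]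
    have hTclosed : IsClosed T := isClosed_range_nonneg_coeff gen
    have hKconv : Convex ℝ K := (convex_closedBall a β).prod (convex_singleton c)
    have hKcomp : IsCompact K := (isCompact_closedBall a β).prod isCompact_singleton
    obtain ⟨f, u, v, hfu, huv, hfv⟩ :=
      geometric_hahn_banach_compact_closed hKconv hKcomp hTconv hTclosed hdisj
    have hv : v < 0 := by simpa using hfv 0 ⟨0, le_rfl, by simp⟩
    have hgen : ∀ o, 0 ≤ f (gen o) := by
      intro o
      by_contra! hneg
      -- This multiple of the generator stays in the cone and has `f`-value exactly `v`, which the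
      -- strict separation forbids.
      have := hfv ((v / f (gen o)) • gen o) ⟨Pi.single o (v / f (gen o)),
        Pi.single_nonneg.2 (div_nonneg_of_nonpos hv.le hneg.le), by
          classical simp [Pi.single_apply, ite_smul]⟩
      rw [map_smul, smul_eq_mul, div_mul_cancel₀ _ hneg.ne] at this
      exact lt_irrefl _ this
    set p : EuclideanSpace ℝ (Fin k) := -(InnerProductSpace.toDual ℝ _).symm
      (f.comp (ContinuousLinearMap.inl ℝ _ ℝ)) with hp
    set w : ℝ := f (0, 1) with hw
    have hf : ∀ x τ, f (x, τ) = -inner ℝ p x + w * τ := by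
      intro x τ
      have h₁ : f (x, 0) = -inner ℝ p x := by
        rw [hp, inner_neg_left, InnerProductSpace.toDual_symm_apply]
        simp
      have h₂ : ((x, τ) : EuclideanSpace ℝ (Fin k) × ℝ) = (x, 0) + τ • (0, 1) := by simp
      rw [h₂, map_add, map_smul, h₁, smul_eq_mul, mul_comm τ]
    have hw0 : 0 ≤ w := hgen none
    have hCp : ∀ i, (C *ᵥ p.ofLp) i ≤ w * (d - C *ᵥ x₀.ofLp) i := by
      intro i
      have := hgen (some i)
      simp only [gen, Option.elim_some, hf] at this
      have h₂ : inner ℝ p (WithLp.toLp 2 (C i)) = (C *ᵥ p.ofLp) i := by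
        simp [Matrix.mulVec, PiLp.inner_apply, dotProduct]
      linarith
    have hgap : w * c < inner ℝ a p - β * ‖p‖ := by
      -- The point `a - z` is where `f` is largest on the ball, so separation there gives the sharp
      -- gap.
      have hz : ∃ z : EuclideanSpace ℝ (Fin k), ‖z‖ ≤ β ∧ inner ℝ p z = β * ‖p‖ := by
        rcases eq_or_ne p 0 with h0 | h0
        · exact ⟨0, by simpa using hβ, by simp [h0]⟩
        · have hn : ‖p‖ ≠ 0 := norm_ne_zero_iff.2 h0
          refine ⟨(β / ‖p‖) • p, ?_, ?_⟩
          · rw [norm_smul, Real.norm_of_nonneg (by positivity), div_mul_cancel₀ _ hn]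
          · rw [inner_smul_right, real_inner_self_eq_norm_sq]
            field_simp
      obtain ⟨z, hz, hpz⟩ := hz
      have := hfu (a - z, c) (by simp [hK, hz])
      rw [hf, inner_sub_right, hpz, real_inner_comm] at this
      linarith
    have hmem : ∀ l : ℝ, 0 ≤ l → l * w ≤ 1 → x₀ + l • p ∈ polyhedron C d := by
      intro l hl hlw i
      have h₁ := mul_le_mul_of_nonneg_left (hCp i) hl
      have h₂ : 0 ≤ (d - C *ᵥ x₀.ofLp) i := sub_nonneg.2 (hx₀ i)
      have h₃ := mul_le_mul_of_nonneg_right hlw h₂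
      simp only [WithLp.ofLp_add, WithLp.ofLp_smul, Matrix.mulVec_add, Matrix.mulVec_smul,
        Pi.add_apply, Pi.smul_apply, smul_eq_mul, Pi.sub_apply] at *
      linarith
    have hle : ∀ l : ℝ, 0 ≤ l → l * w ≤ 1 → l * (inner ℝ a p - β * ‖p‖) ≤ c := by
      intro l hl hlw
      have := h _ (hmem l hl hlw)
      rw [add_sub_cancel_left, inner_smul_right, norm_smul, Real.norm_of_nonneg hl] at this
      linarith
    -- If `w = 0`, then `p` is a recession direction with positive gain, and a long step exceeds
    -- `c`. Otherwise the longest step certified by `hmem`, namely `1 / w`, already does.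
    rcases hw0.eq_or_lt with h0 | h0
    · rw [← h0, zero_mul] at hgap
      have := hle ((|c| + 1) / (inner ℝ a p - β * ‖p‖)) (by positivity) (by simp [← h0])
      rw [div_mul_cancel₀ _ hgap.ne'] at this
      linarith [le_abs_self c]
    · have := hle (1 / w) (by positivity) (by rw [one_div_mul_cancel h0.ne'])
      rw [one_div_mul_eq_div, div_le_iff₀ h0] at this
      linarith
  · obtain ⟨v, hvK, η, hη, hsum⟩ := Set.not_disjoint_iff.1 hdisj
    rw [Fintype.sum_option] at hsum
    refine ⟨fun i => η (some i), fun i => hη _, ?_, ?_⟩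
    · have h₁ : WithLp.toLp 2 ((fun i => η (some i)) ᵥ* C) = v.1 := by
        rw [← hsum]
        ext j
        simp [gen, Prod.fst_sum, Matrix.vecMul, dotProduct]
      rw [h₁, ← dist_eq_norm, dist_comm]
      exact hvK.1
    · have h₁ : η none + (fun i => η (some i)) ⬝ᵥ (d - C *ᵥ x₀.ofLp) = v.2 := by
        rw [← hsum]
        simp [gen, Prod.snd_sum, dotProduct]
      have h₂ : v.2 = c := hvK.2
      have h₃ : 0 ≤ η none := hη none
      linarith

/-! ### Empirical measures -/

section Empirical

variable {X Y : Type*} [MeasurableSpace X] [MeasurableSpace Y] {N : ℕ}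

lemma isProbabilityMeasure_empirical (hN : 0 < N) (ξ : Fin N → X) :
    IsProbabilityMeasure (empirical ξ) := by
  refine ⟨?_⟩
  simp only [empirical, Measure.smul_apply, Measure.finsetSum_apply, measure_univ, smul_eq_mul,
    Finset.sum_const, Finset.card_univ, Fintype.card_fin, nsmul_eq_mul, mul_one]
  exact ENNReal.inv_mul_cancel (by exact_mod_cast hN.ne') (ENNReal.natCast_ne_top N)

lemma integral_empirical [MeasurableSingletonClass X] (ξ : Fin N → X) (f : X → ℝ) :
    ∫ x, f x ∂(empirical ξ) = 1 / (N : ℝ) * ∑ i, f (ξ i) := by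
  rw [empirical, integral_smul_measure, integral_finsetSum_measure]
  · simp [integral_dirac]
  · exact fun i _ => integrable_dirac (by simp)

lemma map_empirical {f : X → Y} (hf : Measurable f) (ξ : Fin N → X) :
    (empirical ξ).map f = empirical (fun i => f (ξ i)) := by
  simp [empirical, Measure.map_smul, Measure.map_finset_sum hf.aemeasurable, Measure.map_dirac' hf]

end Empirical

/-! ### Couplings, weak duality and coercivity of the CVaR objective -/

section Duality

variable {X : Type*} [MetricSpace X] [CompactSpace X] [MeasurableSpace X] [BorelSpace X] {N : ℕ}

lemma integrable_of_continuous_of_compactSpace {Y : Type*} [TopologicalSpace Y] [CompactSpace Y]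
    [MeasurableSpace Y] [OpensMeasurableSpace Y] {μ : Measure Y} [IsFiniteMeasure μ] {f : Y → ℝ}
    (hf : Continuous f) : Integrable f μ :=
  hf.integrable_of_hasCompactSupport (HasCompactSupport.of_compactSpace f)

lemma map_fst_mem_ambiguitySet {ξ : Fin N → X} {r : ℝ} {γ : Measure (X × X)}
    [IsProbabilityMeasure γ] (hsnd : γ.map Prod.snd = empirical ξ)
    (hcost : ∫ z, dist z.1 z.2 ∂γ ≤ r) : γ.map Prod.fst ∈ ambiguitySet 1 ξ r := by
  have hprob : IsProbabilityMeasure (γ.map Prod.fst) :=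
    Measure.isProbabilityMeasure_map measurable_fst.aemeasurable
  obtain ⟨z₀⟩ : Nonempty (X × X) := γ.nonempty_of_neZero
  refine ⟨hprob, ⟨z₀.1, ?_⟩, ?_⟩
  · simp only [ENNReal.rpow_one]
    calc ∫⁻ x, edist x z₀.1 ∂(γ.map Prod.fst)
        ≤ ∫⁻ _, ENNReal.ofReal (Metric.diam (Set.univ : Set X)) ∂(γ.map Prod.fst) := by
          refine lintegral_mono fun x => ?_
          rw [edist_dist]
          exact ENNReal.ofReal_le_ofReal (Metric.dist_le_diam_of_mem
            isCompact_univ.isBounded (Set.mem_univ _) (Set.mem_univ _))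
      _ < ∞ := by simp
  · simp only [wasserstein, ENNReal.rpow_one, div_one]
    refine (iInf₂_le γ ⟨rfl, hsnd⟩).trans ?_
    simp only [edist_dist]
    rw [← ofReal_integral_eq_lintegral_ofReal
      (integrable_of_continuous_of_compactSpace (by fun_prop)) (.of_forall fun _ => dist_nonneg)]
    exact ENNReal.ofReal_le_ofReal hcost

/-- The margin `δ` avoids having to show that the infimum over couplings is attained. -/
lemma exists_coupling_of_mem_ambiguitySet {ξ : Fin N → X} {r δ : ℝ} (hr : 0 ≤ r) (hδ : 0 < δ)
    {μ : Measure X} (hμ : μ ∈ ambiguitySet 1 ξ r) :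
    ∃ γ : Measure (X × X), IsProbabilityMeasure γ ∧ γ.map Prod.fst = μ ∧
      γ.map Prod.snd = empirical ξ ∧ ∫ z, dist z.1 z.2 ∂γ ≤ r + δ := by
  obtain ⟨hprob, -, hW⟩ := hμ
  have hlt : wasserstein 1 μ (empirical ξ) < ENNReal.ofReal (r + δ) :=
    hW.trans_lt ((ENNReal.ofReal_lt_ofReal_iff (by linarith)).2 (by linarith))
  simp only [wasserstein, ENNReal.rpow_one, div_one, iInf_lt_iff, exists_prop] at hlt
  obtain ⟨γ, ⟨h₁, h₂⟩, hlt⟩ := hlt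
  have hγ : IsProbabilityMeasure γ := by
    rw [← h₁] at hprob
    exact Measure.isProbabilityMeasure_of_map Prod.fst
  refine ⟨γ, hγ, h₁, h₂, ?_⟩
  simp only [edist_dist] at hlt
  rw [← ofReal_integral_eq_lintegral_ofReal
    (integrable_of_continuous_of_compactSpace (by fun_prop))
    (.of_forall fun _ => dist_nonneg)] at hlt
  exact (ENNReal.ofReal_lt_ofReal_iff (by linarith)).1 hlt |>.le

lemma worstCaseCVaR_le_zero_of_dual {ξ : Fin N → X} {r ε : ℝ} (hr : 0 ≤ r) (hε : 0 < ε)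
    {G : X → ℝ} (hG : Continuous G) {t β : ℝ} {s : Fin N → ℝ} (hβ : 0 ≤ β)
    (hbudget : β * r + 1 / (N : ℝ) * ∑ i, s i - t * ε ≤ 0) (hs : ∀ i, 0 ≤ s i)
    (hslack : ∀ i x, G x + t - β * dist x (ξ i) ≤ s i) :
    worstCaseCVaR 1 ξ r ε G ≤ 0 := by
  classical
  refine iSup₂_le fun μ hμ => (iInf_le _ t).trans ?_
  rw [← EReal.coe_zero, EReal.coe_le_coe_iff]
  -- Samples may coincide, so `s` need not be a function of the sample point; the smallest value at
  -- each point works. Off the samples the infimum is empty and equals `0`.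
  let S : X → ℝ := fun z => ⨅ i : {i // ξ i = z}, s i
  have hSle : ∀ i, S (ξ i) ≤ s i := fun i =>
    ciInf_le (f := fun j : {j // ξ j = ξ i} => s j) (Set.finite_range _).bddBelow ⟨i, rfl⟩
  have hSmeas : Measurable S := by
    refine measurable_of_measurable_on_compl_finite (Set.range ξ) (Set.finite_range ξ) ?_
    have : (Set.range ξ)ᶜ.domRestrict S = fun _ => 0 := by
      ext z
      have : IsEmpty {i // ξ i = z.1} := ⟨fun i => z.2 ⟨i.1, i.2⟩⟩
      exact Real.iInf_of_isEmpty _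
    rw [this]
    exact measurable_const
  have hSbound : ∀ z ∈ Set.range ξ, ∀ x, max (G x + t) 0 ≤ S z + β * dist x z := by
    rintro _ ⟨i, rfl⟩ x
    rw [← sub_le_iff_le_add]
    have : Nonempty {j // ξ j = ξ i} := ⟨⟨i, rfl⟩⟩
    refine le_ciInf fun j => ?_
    have h₁ := hslack j x
    have h₂ := hs j
    have h₃ : 0 ≤ β * dist x (ξ j) := by positivity
    rw [j.2] at h₁ h₃
    rw [sub_le_iff_le_add]
    exact max_le (by linarith) (by linarith)
  have hE : ∫ x, max (G x + t) 0 ∂μ ≤ t * ε := by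
    refine le_of_forall_pos_le_add fun δ hδ => ?_
    obtain ⟨γ, hγ, h₁, h₂, h₃⟩ := exists_coupling_of_mem_ambiguitySet hr
      (div_pos hδ (by linarith : 0 < β + 1)) hμ
    have hae : ∀ᵐ z ∂γ, z.2 ∈ Set.range ξ := by
      have : ∀ᵐ z ∂(γ.map Prod.snd), z ∈ Set.range ξ := by
        rw [h₂, ae_iff, empirical]
        simp [Measure.smul_apply, Measure.finsetSum_apply, Measure.dirac_apply]
      exact ae_of_ae_map measurable_snd.aemeasurable this
    have hSint : Integrable (fun z : X × X => S z.2) γ := by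
      obtain ⟨b, hb⟩ : ∃ b, ∀ i, |S (ξ i)| ≤ b := by
        obtain ⟨b, hb⟩ := (Set.finite_range fun i => |S (ξ i)|).bddAbove
        exact ⟨b, fun i => hb ⟨i, rfl⟩⟩
      refine Integrable.of_bound (hSmeas.comp measurable_snd).aestronglyMeasurable b ?_
      filter_upwards [hae] with z hz
      obtain ⟨i, hi⟩ := hz
      rw [← hi]
      exact hb i
    have hdint : Integrable (fun z : X × X => β * dist z.1 z.2) γ :=
      integrable_of_continuous_of_compactSpace (by fun_prop)
    have hSemp : ∫ z, S z.2 ∂γ ≤ 1 / (N : ℝ) * ∑ i, s i := by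
      rw [← integral_map (f := S) measurable_snd.aemeasurable hSmeas.aestronglyMeasurable, h₂,
        integral_empirical]
      gcongr with i
      exact hSle i
    have hδ' : β * (δ / (β + 1)) ≤ δ := by
      rw [← mul_div_assoc, div_le_iff₀ (by linarith)]
      nlinarith
    calc ∫ x, max (G x + t) 0 ∂μ = ∫ z, max (G z.1 + t) 0 ∂γ := by
          rw [← h₁, integral_map measurable_fst.aemeasurable]
          exact (by fun_prop : Continuous fun x => max (G x + t) 0).aestronglyMeasurable
      _ ≤ ∫ z, (S z.2 + β * dist z.1 z.2) ∂γ := by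
          refine integral_mono_ae (integrable_of_continuous_of_compactSpace (by fun_prop))
            (hSint.add hdint) ?_
          filter_upwards [hae] with z hz using hSbound _ hz _
      _ = ∫ z, S z.2 ∂γ + β * ∫ z, dist z.1 z.2 ∂γ := by
          rw [integral_add hSint hdint, integral_const_mul]
      _ ≤ t * ε + δ := by
          have := mul_le_mul_of_nonneg_left h₃ hβ
          linarith
  have := mul_le_mul_of_nonneg_left hE (inv_nonneg.2 hε.le)
  rw [mul_comm t, inv_mul_cancel_left₀ hε.ne'] at this
  linarith

/-- Outside the stated interval `𝔼 (G + t)₊ - t * ε` is bounded below automatically: by `1 - ε` for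
large `t`, since `(G + t)₊ ≥ t - B`, and by `ε` for very negative `t`, since the expectation is
nonnegative. The uniform margin `m` keeps the infimum strictly positive. -/
lemma cvar_pos {ε B m : ℝ} (hε : ε ∈ Set.Ioo (0 : ℝ) 1) {μ : Measure X}
    [IsProbabilityMeasure μ] {G : X → ℝ} (hG : Continuous G) (hB : ∀ x, |G x| ≤ B) (hm : 0 < m)
    (h : ∀ t : ℝ, |t| ≤ B / (1 - ε) + 1 → t * ε + m ≤ ∫ x, max (G x + t) 0 ∂μ) :
    0 < cvar ε μ G := by
  obtain ⟨hε₀, hε₁⟩ := hε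
  have hε₂ : 0 < 1 - ε := by linarith
  set m' := min m (min ε (1 - ε)) with hm'
  have hm'pos : 0 < m' := lt_min hm (lt_min hε₀ hε₂)
  have hB₀ : 0 ≤ B := by
    obtain ⟨x⟩ := μ.nonempty_of_neZero
    exact (abs_nonneg _).trans (hB x)
  have hle : ∀ t : ℝ, t * ε + m' ≤ ∫ x, max (G x + t) 0 ∂μ := by
    intro t
    rcases le_or_gt |t| (B / (1 - ε) + 1) with ht | ht
    · linarith [h t ht, min_le_left m (min ε (1 - ε))]
    rcases lt_abs.1 ht with ht | ht
    · have h₁ : ∫ x, (-B + t) ∂μ ≤ ∫ x, max (G x + t) 0 ∂μ := by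
        refine integral_mono (integrable_const _)
          (integrable_of_continuous_of_compactSpace (by fun_prop)) fun x => ?_
        have := (abs_le.1 (hB x)).1
        exact le_max_of_le_left (by linarith)
      rw [integral_const, probReal_univ, one_smul] at h₁
      have h₂ := mul_le_mul_of_nonneg_right ht.le hε₂.le
      rw [add_mul, div_mul_cancel₀ _ hε₂.ne'] at h₂
      have h₃ : m' ≤ 1 - ε := (min_le_right _ _).trans (min_le_right _ _)
      linarith
    · have h₁ : 0 ≤ ∫ x, max (G x + t) 0 ∂μ := integral_nonneg fun x => le_max_right _ _
      have h₂ : 0 ≤ B / (1 - ε) := by positivity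
      have h₃ : m' ≤ ε := (min_le_right _ _).trans (min_le_left _ _)
      nlinarith
  have hpos : (0 : EReal) < ((ε⁻¹ * m' : ℝ) : EReal) := by
    exact_mod_cast mul_pos (inv_pos.2 hε₀) hm'pos
  refine hpos.trans_le (le_iInf fun t => ?_)
  rw [EReal.coe_le_coe_iff]
  have := mul_le_mul_of_nonneg_left (hle t) (inv_nonneg.2 hε₀.le)
  rw [mul_add, mul_comm t, inv_mul_cancel_left₀ hε₀.ne'] at this
  linarith

/-- The infimum in the definition of the CVaR is attained. -/
lemma exists_of_cvar_le_zero {ε : ℝ} (hε : ε ∈ Set.Ioo (0 : ℝ) 1) {μ : Measure X}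
    [IsProbabilityMeasure μ] {G : X → ℝ} (hG : Continuous G) (h : cvar ε μ G ≤ 0) :
    ∃ t : ℝ, ∫ x, max (G x + t) 0 ∂μ ≤ t * ε := by
  obtain ⟨B, hB⟩ : ∃ B, ∀ x, |G x| ≤ B := by
    obtain ⟨B, hB⟩ := isCompact_univ.exists_bound_of_continuousOn hG.continuousOn
    exact ⟨B, fun x => hB x (Set.mem_univ x)⟩
  have hB₀ : 0 ≤ B := by
    obtain ⟨x⟩ := μ.nonempty_of_neZero
    exact (abs_nonneg _).trans (hB x)
  set T := B / (1 - ε) + 1 with hT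
  have hT₀ : 0 ≤ T := by
    have : 0 < 1 - ε := by linarith [hε.2]
    positivity
  have hcont : Continuous fun t : ℝ => ∫ x, max (G x + t) 0 ∂μ - t * ε := by
    refine Continuous.sub ?_ (by fun_prop)
    simpa using continuous_parametric_integral_of_continuous (μ := μ)
      (f := fun (t : ℝ) x => max (G x + t) 0) (by fun_prop) isCompact_univ
  obtain ⟨t, ht, hmin⟩ := (isCompact_Icc (a := -T) (b := T)).exists_isMinOn
    ⟨0, by simpa using hT₀⟩ hcont.continuousOn
  refine ⟨t, ?_⟩
  by_contra! hlt
  refine h.not_gt (cvar_pos hε hG hB (sub_pos.2 hlt) fun t' ht' => ?_)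
  have := isMinOn_iff.1 hmin t' (abs_le.1 ht')
  linarith

end Duality

/-! ### Strong duality by separation in `ℝ³` -/

section Attainment

variable {X : Type*} [MetricSpace X] [CompactSpace X] [MeasurableSpace X] [BorelSpace X] {N : ℕ}

/-- The points `(a, b, c)` for which some coupling with the empirical distribution costs at most
`r - c` and has `t ↦ a + t * b` as a lower bound of `t ↦ 𝔼 (G + t)₊ - t * ε`. -/
def couplingBounds (ξ : Fin N → X) (r ε : ℝ) (G : X → ℝ) : Set (ℝ × ℝ × ℝ) :=
  {c | ∃ γ : Measure (X × X), IsProbabilityMeasure γ ∧ γ.map Prod.snd = empirical ξ ∧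
    ∫ z, dist z.1 z.2 ∂γ ≤ r - c.2.2 ∧
    ∀ t, c.1 + t * (c.2.1 + ε) ≤ ∫ z, max (G z.1 + t) 0 ∂γ}

/-- Mixing two couplings keeps the second marginal and mixes cost and expectations linearly. -/
lemma convex_couplingBounds (ξ : Fin N → X) (r ε : ℝ) {G : X → ℝ} (hG : Continuous G) :
    Convex ℝ (couplingBounds ξ r ε G) := by
  rintro c₁ ⟨γ₁, hp₁, hm₁, hd₁, hb₁⟩ c₂ ⟨γ₂, hp₂, hm₂, hd₂, hb₂⟩ a b ha hb hab
  have hsum : ENNReal.ofReal a + ENNReal.ofReal b = 1 := by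
    rw [← ENNReal.ofReal_add ha hb, hab, ENNReal.ofReal_one]
  have hint : ∀ f : X × X → ℝ, Continuous f →
      ∫ z, f z ∂(ENNReal.ofReal a • γ₁ + ENNReal.ofReal b • γ₂) =
        a * ∫ z, f z ∂γ₁ + b * ∫ z, f z ∂γ₂ := by
    intro f hf
    rw [integral_add_measure
      ((integrable_of_continuous_of_compactSpace hf).smul_measure ENNReal.ofReal_ne_top)
      ((integrable_of_continuous_of_compactSpace hf).smul_measure ENNReal.ofReal_ne_top),
      integral_smul_measure, integral_smul_measure, ENNReal.toReal_ofReal ha,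
      ENNReal.toReal_ofReal hb, smul_eq_mul, smul_eq_mul]
  refine ⟨ENNReal.ofReal a • γ₁ + ENNReal.ofReal b • γ₂, ⟨?_⟩, ?_, ?_, fun t => ?_⟩
  · simp [hsum]
  · rw [Measure.map_add _ _ measurable_snd, Measure.map_smul, Measure.map_smul, hm₁, hm₂,
      ← add_smul, hsum, one_smul]
  · rw [hint _ (by fun_prop)]
    have h₁ := mul_le_mul_of_nonneg_left hd₁ ha
    have h₂ := mul_le_mul_of_nonneg_left hd₂ hb
    have h₃ : a * r + b * r = r := by rw [← add_mul, hab, one_mul]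
    simp only [Prod.snd_add, Prod.smul_snd, smul_eq_mul]
    linarith
  · rw [hint _ (by fun_prop)]
    have h₁ := mul_le_mul_of_nonneg_left (hb₁ t) ha
    have h₂ := mul_le_mul_of_nonneg_left (hb₂ t) hb
    have h₃ : a * (t * ε) + b * (t * ε) = t * ε := by rw [← add_mul, hab, one_mul]
    simp only [Prod.snd_add, Prod.smul_snd, Prod.fst_add, Prod.smul_fst, smul_eq_mul]
    linarith

/-- Moving each sample `ξ i` to `x i` gives a coupling, and `l * v ≤ max v 0` for `l ∈ [0, 1]` gives
the affine lower bound. -/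
lemma mem_couplingBounds (hN : 0 < N) (ξ x : Fin N → X) (r ε : ℝ) {G : X → ℝ} (l : Fin N → ℝ)
    (hl₀ : ∀ i, 0 ≤ l i) (hl₁ : ∀ i, l i ≤ 1) :
    (1 / (N : ℝ) * ∑ i, l i * G (x i), 1 / (N : ℝ) * ∑ i, l i - ε,
      r - 1 / (N : ℝ) * ∑ i, dist (x i) (ξ i)) ∈ couplingBounds ξ r ε G := by
  refine ⟨empirical fun i => (x i, ξ i), isProbabilityMeasure_empirical hN _,
    map_empirical measurable_snd _, ?_, fun t => ?_⟩
  · rw [integral_empirical, sub_sub_cancel]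
  · rw [integral_empirical, sub_add_cancel, mul_left_comm, ← mul_add, Finset.mul_sum,
      ← Finset.sum_add_distrib]
    refine mul_le_mul_of_nonneg_left (Finset.sum_le_sum fun i _ => ?_) (by positivity)
    have h₁ := mul_le_mul_of_nonneg_left (le_max_left (G (x i) + t) 0) (hl₀ i)
    have h₂ := mul_le_mul_of_nonneg_right (hl₁ i) (le_max_right (G (x i) + t) 0)
    linarith

/-- Each sign is forced by sending one coordinate of the cone to infinity. When `W₀ = 0` the
coordinate `a` is free, so `b` can be arbitrary and `W₁` must vanish. -/
lemma exists_normal_of_forall_pos {W₀ W₁ W₂ T : ℝ}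
    (h : ∀ a b c : ℝ, T * |b| < a → 0 < c → 0 ≤ W₀ * a + W₁ * b + W₂ * c) :
    0 ≤ W₀ ∧ 0 ≤ W₂ ∧ (W₀ = 0 → W₁ = 0) := by
  refine ⟨?_, ?_, fun h₀ => ?_⟩
  · by_contra! hneg
    have hne : W₀ ≠ 0 := hneg.ne
    have hpos : 0 < -W₀ := by linarith
    have := h ((|W₂| + 1) / (-W₀)) 0 1 (by rw [abs_zero, mul_zero]; positivity) one_pos
    have h₂ : W₀ * ((|W₂| + 1) / (-W₀)) = -(|W₂| + 1) := by field_simp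
    rw [h₂] at this
    linarith [le_abs_self W₂]
  · by_contra! hneg
    have hne : W₂ ≠ 0 := hneg.ne
    have hpos : 0 < -W₂ := by linarith
    have := h 1 0 ((|W₀| + 1) / (-W₂)) (by simp) (by positivity)
    have h₂ : W₂ * ((|W₀| + 1) / (-W₂)) = -(|W₀| + 1) := by field_simp
    rw [h₂] at this
    linarith [le_abs_self W₀]
  · by_contra hne
    have := h (T * |(-(W₂ + 1)) / W₁| + 1) (-(W₂ + 1) / W₁) 1 (by linarith) one_pos
    rw [h₀, mul_div_cancel₀ _ hne] at this
    linarith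

/-- If no point of `couplingBounds` witnesses a positive worst-case CVaR, a supporting hyperplane
gives multipliers for the transport budget and the shift. -/
lemma exists_multipliers_couplingBounds (hN : 0 < N) (ξ : Fin N → X) {r ε : ℝ} (hr : 0 < r)
    (hε : ε ∈ Set.Ioo (0 : ℝ) 1) {G : X → ℝ} (hG : Continuous G) (T : ℝ)
    (hT : ∀ c ∈ couplingBounds ξ r ε G, T * |c.2.1| < c.1 → c.2.2 ≤ 0) :
    ∃ t β : ℝ, 0 ≤ β ∧ ∀ c ∈ couplingBounds ξ r ε G, c.1 + t * c.2.1 + β * c.2.2 ≤ 0 := by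
  -- Nonnegativity of the slope makes `Q` convex, and enlarging `T` only shrinks `Q`.
  set T' := max T 0 with hT'
  set Q : Set (ℝ × ℝ × ℝ) := {c | T' * |c.2.1| < c.1} ∩ {c | 0 < c.2.2} with hQ
  have hmemQ : ∀ {a b c : ℝ}, T' * |b| < a → 0 < c → (a, b, c) ∈ Q := fun h₁ h₂ =>
    Set.mem_inter (Set.mem_ofPred_eq ▸ h₁) (Set.mem_ofPred_eq ▸ h₂)
  have hQconv : Convex ℝ Q := by
    refine Convex.inter ?_ ?_
    · rintro c₁ h₁ c₂ h₂ a b ha hb hab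
      simp only [Set.mem_ofPred_eq, Prod.snd_add, Prod.smul_snd, Prod.fst_add, Prod.smul_fst,
        smul_eq_mul] at h₁ h₂ ⊢
      have h₃ : |a * c₁.2.1 + b * c₂.2.1| ≤ a * |c₁.2.1| + b * |c₂.2.1| := by
        refine (abs_add_le _ _).trans_eq ?_
        rw [abs_mul, abs_mul, abs_of_nonneg ha, abs_of_nonneg hb]
      have h₄ := mul_le_mul_of_nonneg_left h₃ (le_max_right T 0)
      have h₅ : a * (c₁.1 - T' * |c₁.2.1|) + b * (c₂.1 - T' * |c₂.2.1|) > 0 := by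
        rcases ha.eq_or_lt with rfl | ha
        · rw [zero_add] at hab
          subst hab
          linarith
        · have := mul_pos ha (sub_pos.2 h₁)
          have := mul_nonneg hb (sub_pos.2 h₂).le
          linarith
      linarith
    · exact convex_halfSpace_gt (f := fun c : ℝ × ℝ × ℝ => c.2.2) ⟨by simp, by simp⟩ 0
  have hQopen : IsOpen Q := by
    refine IsOpen.inter (isOpen_lt ?_ ?_) (isOpen_lt ?_ ?_) <;> fun_prop
  have hdisj : Disjoint Q (couplingBounds ξ r ε G) := by
    refine Set.disjoint_left.2 fun c hc hc' => hc.2.not_ge (hT c hc' (lt_of_le_of_lt ?_ hc.1))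
    exact mul_le_mul_of_nonneg_right (le_max_left _ _) (abs_nonneg _)
  obtain ⟨f, u, hfQ, hfD⟩ := geometric_hahn_banach_open hQconv hQopen
    (convex_couplingBounds ξ r ε hG) hdisj
  have hf : ∀ a b c : ℝ, f (a, b, c) = f (1, 0, 0) * a + f (0, 1, 0) * b + f (0, 0, 1) * c := by
    intro a b c
    have : ((a, b, c) : ℝ × ℝ × ℝ) = a • (1, 0, 0) + b • (0, 1, 0) + c • (0, 0, 1) := by simp
    rw [this, map_add, map_add, map_smul, map_smul, map_smul]
    simp only [smul_eq_mul]
    ring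
  set W₀ := -f (1, 0, 0)
  set W₁ := -f (0, 1, 0)
  set W₂ := -f (0, 0, 1)
  have hf' : ∀ a b c : ℝ, f (a, b, c) = -(W₀ * a + W₁ * b + W₂ * c) := fun a b c => by
    rw [hf]; ring
  have hscale : ∀ a b c : ℝ, T' * |b| < a → 0 < c → ∀ θ > 0,
      -(θ * (W₀ * a + W₁ * b + W₂ * c)) < u := by
    intro a b c hab hc θ hθ
    have hab' : T' * |θ * b| < θ * a := by
      rw [abs_mul, abs_of_pos hθ]
      linarith [mul_lt_mul_of_pos_left hab hθ]
    have := hfQ _ (hmemQ hab' (mul_pos hθ hc))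
    rw [hf'] at this
    linarith
  -- `Q` is stable under positive scaling: shrinking a point to the origin gives `0 ≤ u`, and
  -- stretching it below gives `f ≤ 0` on `Q`.
  have hu : 0 ≤ u := by
    by_contra! hneg
    have hA : 0 < |W₀ * 1 + W₁ * 0 + W₂ * 1| + 1 := by positivity
    have := hscale 1 0 1 (by simp) one_pos (-u / (|W₀ * 1 + W₁ * 0 + W₂ * 1| + 1))
      (div_pos (by linarith) hA)
    rw [div_mul_eq_mul_div, ← neg_div, div_lt_iff₀ hA] at this
    nlinarith [le_abs_self (W₀ * 1 + W₁ * 0 + W₂ * 1)]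
  have hpos : ∀ a b c : ℝ, T' * |b| < a → 0 < c → 0 ≤ W₀ * a + W₁ * b + W₂ * c := by
    intro a b c hab hc
    by_contra! hneg
    have := hscale a b c hab hc ((u + 1) / -(W₀ * a + W₁ * b + W₂ * c))
      (div_pos (by linarith) (by linarith))
    rw [← mul_neg, div_mul_cancel₀ _ (by linarith)] at this
    linarith
  obtain ⟨hW₀, hW₂, hW₁⟩ := exists_normal_of_forall_pos hpos
  have hD : ∀ c ∈ couplingBounds ξ r ε G, W₀ * c.1 + W₁ * c.2.1 + W₂ * c.2.2 ≤ 0 := by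
    intro c hc
    have := hfD c hc
    rw [show c = (c.1, c.2.1, c.2.2) from rfl, hf'] at this
    linarith
  -- Slater argument: the identity coupling has spare budget `r > 0`, so `W₀ = 0` would force `W₁ =
  -- W₂ = 0`, contradicting strict separation on `Q`. The weights `ε` are immaterial here.
  have hW₀pos : 0 < W₀ := by
    refine hW₀.lt_of_ne' fun h₀ => ?_
    have hmem := mem_couplingBounds hN ξ ξ r ε (G := G) (fun _ => ε) (fun _ => hε.1.le)
      (fun _ => hε.2.le)
    have h₁ := hD _ hmem
    have h₂ := hfD _ hmem
    have h₃ := hfQ (1, 0, 1) (hmemQ (by simp) one_pos)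
    rw [hf', h₀, hW₁ h₀] at h₂ h₃
    simp only [h₀, hW₁ h₀, dist_self, Finset.sum_const_zero, mul_zero, sub_zero, zero_mul,
      zero_add] at h₁ h₂ h₃
    have h₄ : W₂ = 0 := le_antisymm (nonpos_of_mul_nonpos_left h₁ hr) hW₂
    rw [h₄] at h₂ h₃
    linarith
  refine ⟨W₁ / W₀, W₂ / W₀, by positivity, fun c hc => ?_⟩
  have := div_nonpos_of_nonpos_of_nonneg (hD c hc) hW₀pos.le
  have heq : (W₀ * c.1 + W₁ * c.2.1 + W₂ * c.2.2) / W₀ =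
      c.1 + W₁ / W₀ * c.2.1 + W₂ / W₀ * c.2.2 := by field_simp
  linarith

lemma exists_dual_of_worstCaseCVaR_le_zero_of_pos (hN : 0 < N) {ξ : Fin N → X} {r ε : ℝ}
    (hr : 0 < r) (hε : ε ∈ Set.Ioo (0 : ℝ) 1) {G : X → ℝ} (hG : Continuous G)
    (h : worstCaseCVaR 1 ξ r ε G ≤ 0) :
    ∃ (t β : ℝ) (s : Fin N → ℝ), 0 ≤ β ∧ β * r + 1 / (N : ℝ) * ∑ i, s i - t * ε ≤ 0 ∧
      (∀ i, 0 ≤ s i) ∧ ∀ i x, G x + t - β * dist x (ξ i) ≤ s i := by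
  obtain ⟨B, hB⟩ : ∃ B, ∀ x, |G x| ≤ B := by
    obtain ⟨B, hB⟩ := isCompact_univ.exists_bound_of_continuousOn hG.continuousOn
    exact ⟨B, fun x => hB x (Set.mem_univ x)⟩
  -- A point with `T * |b| < a` bounds the CVaR objective below by `a - T * |b| > 0` for `|t| ≤ T`.
  -- With `T` from `cvar_pos`, nonnegative spare budget would then give a measure in the ball with
  -- positive CVaR.
  obtain ⟨t, β, hβ, hD⟩ := exists_multipliers_couplingBounds hN ξ hr hε hG (B / (1 - ε) + 1) <| by
    rintro c ⟨γ, hp, hm, hd, hb⟩ hc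
    by_contra! hpos
    have hmem := map_fst_mem_ambiguitySet hm (hd.trans (by linarith : _ ≤ r))
    have := hmem.1
    refine ((le_iSup₂ (f := fun μ _ => cvar ε μ G) _ hmem).trans h).not_gt
      (cvar_pos hε hG hB (sub_pos.2 hc) fun t ht => ?_)
    rw [integral_map measurable_fst.aemeasurable
      (by fun_prop : Continuous fun x => max (G x + t) 0).aestronglyMeasurable]
    have h₁ := hb t
    have h₂ := mul_le_mul_of_nonneg_right ht (abs_nonneg c.2.1)
    rw [← abs_mul] at h₂
    linarith [neg_abs_le (t * c.2.1)]
  have hmax : ∀ i, ∃ x, ∀ z, max (G z + t) 0 - β * dist z (ξ i) ≤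
      max (G x + t) 0 - β * dist x (ξ i) := by
    intro i
    obtain ⟨x, -, hx⟩ := isCompact_univ.exists_isMaxOn ⟨ξ i, Set.mem_univ _⟩
      (by fun_prop : Continuous fun z => max (G z + t) 0 - β * dist z (ξ i)).continuousOn
    exact ⟨x, fun z => isMaxOn_iff.1 hx z (Set.mem_univ z)⟩
  choose x hx using hmax
  classical
  -- These weights make `l * v ≤ max v 0` an equality at the maximizers, so the separation
  -- inequality at this transport plan is the budget constraint.
  set l : Fin N → ℝ := fun i => if 0 ≤ G (x i) + t then 1 else 0 with hl
  have hlmax : ∀ i, max (G (x i) + t) 0 = l i * (G (x i) + t) := by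
    intro i
    by_cases h₀ : 0 ≤ G (x i) + t
    · simp [hl, h₀]
    · simp [hl, h₀, (not_le.1 h₀).le]
  refine ⟨t, β, fun i => max (G (x i) + t) 0 - β * dist (x i) (ξ i), hβ, ?_, fun i => ?_,
    fun i z => ?_⟩
  · have := hD _ (mem_couplingBounds hN ξ x r ε l
      (fun i => by by_cases h₀ : 0 ≤ G (x i) + t <;> simp [hl, h₀])
      (fun i => by by_cases h₀ : 0 ≤ G (x i) + t <;> simp [hl, h₀]))
    simp only [hlmax, mul_add, Finset.sum_sub_distrib, Finset.sum_add_distrib, ← Finset.mul_sum,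
      ← Finset.sum_mul] at this ⊢
    linarith
  · have := hx i (ξ i)
    rw [dist_self, mul_zero, sub_zero] at this
    exact (le_max_right _ _).trans this
  · exact (sub_le_sub_right (le_max_left _ _) _).trans (hx i z)

/-- Without spare budget the separation argument fails, but `β` is free of charge: the Lipschitz
constant makes each `ξ i` maximize `G x - β * dist x (ξ i)`. Only the CVaR under the empirical
measure is needed. -/
lemma exists_dual_of_worstCaseCVaR_le_zero_of_radius_zero (hN : 0 < N) {ξ : Fin N → X} {ε : ℝ}
    (hε : ε ∈ Set.Ioo (0 : ℝ) 1) {G : X → ℝ} {L : NNReal} (hG : LipschitzWith L G)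
    (h : worstCaseCVaR 1 ξ 0 ε G ≤ 0) :
    ∃ (t β : ℝ) (s : Fin N → ℝ), 0 ≤ β ∧ β * 0 + 1 / (N : ℝ) * ∑ i, s i - t * ε ≤ 0 ∧
      (∀ i, 0 ≤ s i) ∧ ∀ i x, G x + t - β * dist x (ξ i) ≤ s i := by
  have := isProbabilityMeasure_empirical hN ξ
  have := isProbabilityMeasure_empirical hN fun i => (ξ i, ξ i)
  have hmem : empirical ξ ∈ ambiguitySet 1 ξ 0 := by
    have := map_fst_mem_ambiguitySet (ξ := ξ) (r := 0) (γ := empirical fun i => (ξ i, ξ i))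
      (map_empirical measurable_snd _) (by rw [integral_empirical]; simp)
    rwa [map_empirical measurable_fst] at this
  obtain ⟨t, ht⟩ := exists_of_cvar_le_zero hε hG.continuous
    ((le_iSup₂ (f := fun μ _ => cvar ε μ G) _ hmem).trans h)
  rw [integral_empirical] at ht
  refine ⟨t, L, fun i => max (G (ξ i) + t) 0, L.2, by linarith, fun i => le_max_right _ _,
    fun i x => le_max_of_le_left ?_⟩
  have h₁ := hG.dist_le_mul x (ξ i)
  rw [Real.dist_eq] at h₁
  linarith [le_abs_self (G x - G (ξ i))]

/-- Strong duality for the worst-case CVaR constraint, with attained multipliers. -/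
lemma worstCaseCVaR_le_zero_iff (hN : 0 < N) {ξ : Fin N → X} {r ε : ℝ} (hr : 0 ≤ r)
    (hε : ε ∈ Set.Ioo (0 : ℝ) 1) {G : X → ℝ} {L : NNReal} (hG : LipschitzWith L G) :
    worstCaseCVaR 1 ξ r ε G ≤ 0 ↔
    ∃ (t β : ℝ) (s : Fin N → ℝ), 0 ≤ β ∧ β * r + 1 / (N : ℝ) * ∑ i, s i - t * ε ≤ 0 ∧
      (∀ i, 0 ≤ s i) ∧ ∀ i x, G x + t - β * dist x (ξ i) ≤ s i := by
  refine ⟨fun h => ?_, ?_⟩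
  · rcases hr.eq_or_lt with rfl | hr
    · exact exists_dual_of_worstCaseCVaR_le_zero_of_radius_zero hN hε hG h
    · exact exists_dual_of_worstCaseCVaR_le_zero_of_pos hN hr hε hG.continuous h
  · rintro ⟨t, β, s, hβ, hbudget, hs, hslack⟩
    exact worstCaseCVaR_le_zero_of_dual hr hε.1 hG.continuous hβ hbudget hs hslack

end Attainment

/-! ### Calculus of second-order cone representable sets -/

section SecondOrderCone

variable {E : Type*} [AddCommGroup E] [Module ℝ E]

/-- Sets given by finitely many second-order cone constraints. -/
def IsSOCRepresentable (F : Set E) : Prop :=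
  ∃ (ι : Type) (_ : Finite ι) (dim : ι → ℕ)
    (A : (j : ι) → E →ₗ[ℝ] EuclideanSpace ℝ (Fin (dim j)))
    (b : (j : ι) → EuclideanSpace ℝ (Fin (dim j)))
    (c : ι → E →ₗ[ℝ] ℝ) (e : ι → ℝ),
    F = {z | ∀ j, ‖A j z + b j‖ ≤ c j z + e j}

lemma isSOCRepresentable_cone {n : ℕ} {f : E → EuclideanSpace ℝ (Fin n)} (hf : IsLinearMap ℝ f)
    (b : EuclideanSpace ℝ (Fin n)) {g : E → ℝ} (hg : IsLinearMap ℝ g) (e : ℝ) :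
    IsSOCRepresentable {z | ‖f z + b‖ ≤ g z + e} :=
  ⟨Unit, inferInstance, fun _ => n, fun _ => hf.mk' f, fun _ => b, fun _ => hg.mk' g, fun _ => e,
    by ext z; simp⟩

lemma isSOCRepresentable_halfspace {g : E → ℝ} (hg : IsLinearMap ℝ g) (e : ℝ) :
    IsSOCRepresentable {z | 0 ≤ g z + e} := by
  have := isSOCRepresentable_cone (n := 0) (f := fun _ : E => 0) ⟨by simp, by simp⟩ 0 hg e
  simpa using this

lemma IsSOCRepresentable.inter {F F' : Set E} (h : IsSOCRepresentable F)
    (h' : IsSOCRepresentable F') : IsSOCRepresentable (F ∩ F') := by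
  obtain ⟨ι, _, dim, A, b, c, e, rfl⟩ := h
  obtain ⟨ι', _, dim', A', b', c', e', rfl⟩ := h'
  refine ⟨ι ⊕ ι', inferInstance, Sum.elim dim dim',
    fun j => match j with | .inl j => A j | .inr j => A' j,
    fun j => match j with | .inl j => b j | .inr j => b' j,
    Sum.elim c c', Sum.elim e e', ?_⟩
  ext z
  simp only [Set.mem_inter_iff, Set.mem_ofPred_eq, Sum.forall]
  rfl

lemma IsSOCRepresentable.iInter {κ : Type} [Finite κ] {F : κ → Set E}
    (h : ∀ i, IsSOCRepresentable (F i)) : IsSOCRepresentable (⋂ i, F i) := by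
  choose ι hfin dim A b c e hF using h
  refine ⟨Σ i, ι i, inferInstance, fun j => dim j.1 j.2, fun j => A j.1 j.2, fun j => b j.1 j.2,
    fun j => c j.1 j.2, fun j => e j.1 j.2, ?_⟩
  ext z
  simp only [hF, Set.mem_iInter, Set.mem_ofPred_eq, Sigma.forall]

end SecondOrderCone

/-! ### The reformulation as a second-order cone program -/

section Reformulation

variable {m k N M q : ℕ} {C : Matrix (Fin q) (Fin k) ℝ} {d : Fin q → ℝ}

/-- Squaring works because `(y + 1) ^ 2 - (y - 1) ^ 2 = 4 * y`. -/
lemma sqrt_epigraph_iff {u κ : EuclideanSpace ℝ (Fin (m + 1))} {y : ℝ} :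
    √(‖(2 : ℝ) • (u - κ)‖ ^ 2 + (y - 1) ^ 2) ≤ y + 1 ↔ ‖u - κ‖ ^ 2 ≤ y := by
  rw [Real.sqrt_le_iff, norm_smul, Real.norm_ofNat, mul_pow]
  constructor
  · rintro ⟨-, h⟩
    nlinarith
  · intro h
    have := sq_nonneg ‖u - κ‖
    exact ⟨by linarith, by nlinarith⟩

/-- The second-order cone vector of the epigraph constraint. -/
lemma sqrt_epigraph_eq_norm (u κ : EuclideanSpace ℝ (Fin (m + 1))) (y : ℝ) :
    √(‖(2 : ℝ) • (u - κ)‖ ^ 2 + (y - 1) ^ 2) =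
      ‖(WithLp.toLp 2 (Fin.cons y fun i => 2 * u i) : EuclideanSpace ℝ (Fin (m + 1 + 1))) +
        WithLp.toLp 2 (Fin.cons (-1) fun i => -(2 * κ i))‖ := by
  rw [← Real.sqrt_sq (norm_nonneg (WithLp.toLp 2 _ + _)), EuclideanSpace.norm_sq_eq,
    EuclideanSpace.norm_sq_eq, Fin.sum_univ_succ (n := m + 1), add_comm]
  congr 1
  simp [sub_eq_add_neg]

lemma isSOCP_socp (ξ : Fin N → EuclideanSpace ℝ (Fin k)) (r ε : ℝ)
    (κ : EuclideanSpace ℝ (Fin (m + 1))) (qv : Fin M → EuclideanSpace ℝ (Fin (m + 1)))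
    (R : Fin M → Matrix (Fin (m + 1)) (Fin k) ℝ) (a : Fin M → ℝ) :
    (socp C d ξ r ε κ qv R a).IsSOCP := by
  refine ⟨⟨(LinearMap.fst ℝ ℝ _).comp (LinearMap.snd ℝ _ _), fun z => rfl⟩, ?_⟩
  change IsSOCRepresentable _
  -- The equation `u 0 = 1` becomes two half-spaces, and the added constants, even zero, exhibit
  -- every constraint as linear part plus offset.
  have heq : (socp C d ξ r ε κ qv R a).feasible =
      {z | 0 ≤ z.1 0 + (-1)} ∩ {z | 0 ≤ -z.1 0 + 1} ∩
      (⋂ l, {z | 0 ≤ z.2.2.2.2.1 l + 0}) ∩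
      (⋂ l, {z | 0 ≤ z.2.2.1 l * ε - z.2.2.2.2.1 l * r
        - (1 / (N : ℝ)) * ∑ i, z.2.2.2.1 l i + 0}) ∩
      (⋂ l, ⋂ i, {z | 0 ≤ z.2.2.2.1 l i + 0}) ∩
      (⋂ l, ⋂ i, {z | 0 ≤ z.2.2.2.1 l i - (z.1.ofLp ⬝ᵥ (qv l).ofLp + z.2.2.1 l
        + (z.1.ofLp ᵥ* R l - z.2.2.2.2.2 l i ᵥ* C) ⬝ᵥ (ξ i).ofLp
        + z.2.2.2.2.2 l i ⬝ᵥ d) + -a l}) ∩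
      (⋂ l, ⋂ i, {z | ‖WithLp.toLp 2 (z.1.ofLp ᵥ* R l - z.2.2.2.2.2 l i ᵥ* C) + 0‖ ≤
        z.2.2.2.2.1 l + 0}) ∩
      (⋂ l, ⋂ i, ⋂ j, {z | 0 ≤ z.2.2.2.2.2 l i j + 0}) ∩
      {z | ‖(WithLp.toLp 2 (Fin.cons z.2.1 fun i => 2 * z.1 i) :
          EuclideanSpace ℝ (Fin (m + 1 + 1))) +
        WithLp.toLp 2 (Fin.cons (-1) fun i => -(2 * κ i))‖ ≤ z.2.1 + 1} := by
    ext ⟨u, y, t, s, β, η⟩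
    simp only [Set.mem_inter_iff, Set.mem_iInter, Set.mem_ofPred_eq, ← sqrt_epigraph_eq_norm,
      add_zero]
    constructor
    · rintro ⟨h₁, h₂, h₃, h₄, h₅, h₆, h₇, h₈⟩
      have h₁ : u 0 = 1 := h₁
      exact ⟨⟨⟨⟨⟨⟨⟨⟨by linarith, by linarith⟩, h₂⟩, fun l => by linarith [h₃ l]⟩, h₄⟩,
        fun l i => by linarith [h₅ l i]⟩, h₆⟩, fun l i j => h₇ l i j⟩, h₈⟩
    · rintro ⟨⟨⟨⟨⟨⟨⟨⟨h₁, h₁'⟩, h₂⟩, h₃⟩, h₄⟩, h₅⟩, h₆⟩, h₇⟩, h₈⟩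
      exact ⟨show u 0 = 1 by linarith, h₂, fun l => by linarith [h₃ l], h₄,
        fun l i => by linarith [h₅ l i], h₆, fun l i j => h₇ l i j, h₈⟩
  rw [heq]
  refine ((((((((IsSOCRepresentable.inter ?_ ?_).inter ?_).inter ?_).inter ?_).inter ?_).inter
    ?_).inter ?_).inter ?_)
  · exact isSOCRepresentable_halfspace ⟨fun _ _ => by simp, fun _ _ => by simp⟩ _
  · exact isSOCRepresentable_halfspace ⟨fun _ _ => by simp; ring, fun _ _ => by simp⟩ _
  · refine .iInter fun l => isSOCRepresentable_halfspace ⟨fun _ _ => ?_, fun _ _ => ?_⟩ _ <;> simp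
  · refine .iInter fun l => isSOCRepresentable_halfspace ⟨fun _ _ => ?_, fun _ _ => ?_⟩ _
    · simp only [Prod.snd_add, Prod.fst_add, Pi.add_apply, Finset.sum_add_distrib]
      ring
    · simp only [Prod.smul_snd, Prod.smul_fst, Pi.smul_apply, smul_eq_mul, ← Finset.mul_sum]
      ring
  · refine .iInter fun l => .iInter fun i => isSOCRepresentable_halfspace
      ⟨fun _ _ => ?_, fun _ _ => ?_⟩ _ <;> simp
  · refine .iInter fun l => .iInter fun i => isSOCRepresentable_halfspace
      ⟨fun _ _ => ?_, fun _ _ => ?_⟩ _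
    · simp only [Prod.snd_add, Prod.fst_add, Pi.add_apply, WithLp.ofLp_add, Matrix.add_vecMul,
        add_dotProduct, sub_dotProduct]
      ring
    · simp only [Prod.smul_snd, Prod.smul_fst, Pi.smul_apply, smul_eq_mul, WithLp.ofLp_smul,
        Matrix.smul_vecMul, smul_dotProduct, sub_dotProduct]
      ring
  · refine .iInter fun l => .iInter fun i => isSOCRepresentable_cone
      ⟨fun _ _ => ?_, fun _ _ => ?_⟩ _ ⟨fun _ _ => ?_, fun _ _ => ?_⟩ _
    · simp only [Prod.snd_add, Prod.fst_add, Pi.add_apply, WithLp.ofLp_add, Matrix.add_vecMul,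
        ← WithLp.toLp_add]
      congr 1
      abel
    · simp only [Prod.smul_snd, Prod.smul_fst, Pi.smul_apply, WithLp.ofLp_smul,
        Matrix.smul_vecMul, ← smul_sub, WithLp.toLp_smul]
    · simp
    · simp
  · refine .iInter fun l => .iInter fun i => .iInter fun j => isSOCRepresentable_halfspace
      ⟨fun _ _ => ?_, fun _ _ => ?_⟩ _ <;> simp
  · refine isSOCRepresentable_cone ⟨fun _ _ => ?_, fun _ _ => ?_⟩ _
      ⟨fun _ _ => by simp, fun _ _ => by simp⟩ _
    · ext j
      refine Fin.cases ?_ (fun j => ?_) j <;> simp [mul_add]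
    · ext j
      refine Fin.cases ?_ (fun j => ?_) j <;> simp [mul_left_comm]

lemma inner_toLp_eq_dotProduct {n : ℕ} (v : Fin n → ℝ) (x : EuclideanSpace ℝ (Fin n)) :
    inner ℝ (WithLp.toLp 2 v) x = v ⬝ᵥ x.ofLp := by
  simp [PiLp.inner_apply, dotProduct, mul_comm]

lemma affineG_sub (qv : EuclideanSpace ℝ (Fin (m + 1))) (R : Matrix (Fin (m + 1)) (Fin k) ℝ)
    (a : ℝ) (u : EuclideanSpace ℝ (Fin (m + 1))) (x x₀ : EuclideanSpace ℝ (Fin k)) :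
    affineG qv R a u x - affineG qv R a u x₀ =
      inner ℝ (WithLp.toLp 2 (u.ofLp ᵥ* R)) (x - x₀) := by
  rw [inner_toLp_eq_dotProduct, WithLp.ofLp_sub, dotProduct_sub]
  simp only [affineG]
  ring

lemma lipschitzWith_affineG (qv : EuclideanSpace ℝ (Fin (m + 1)))
    (R : Matrix (Fin (m + 1)) (Fin k) ℝ) (a : ℝ) (u : EuclideanSpace ℝ (Fin (m + 1))) :
    LipschitzWith ‖WithLp.toLp 2 (u.ofLp ᵥ* R)‖₊ (affineG qv R a u) := by
  refine LipschitzWith.of_dist_le_mul fun x x₀ => ?_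
  rw [Real.dist_eq, affineG_sub, dist_eq_norm, coe_nnnorm]
  exact abs_real_inner_le_norm _ _

/-- The robust slack constraint over the polyhedron in terms of multipliers. -/
lemma forall_affineG_sub_dist_le_iff {x₀ : EuclideanSpace ℝ (Fin k)} (hx₀ : x₀ ∈ polyhedron C d)
    (qv : EuclideanSpace ℝ (Fin (m + 1))) (R : Matrix (Fin (m + 1)) (Fin k) ℝ) (a : ℝ)
    (u : EuclideanSpace ℝ (Fin (m + 1))) {t β s : ℝ} (hβ : 0 ≤ β) :
    (∀ x : polyhedron C d, affineG qv R a u x + t - β * dist (x : EuclideanSpace ℝ (Fin k)) x₀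
      ≤ s) ↔
    ∃ η : Fin q → ℝ, 0 ≤ η ∧
      u.ofLp ⬝ᵥ qv.ofLp + t + (u.ofLp ᵥ* R - η ᵥ* C) ⬝ᵥ x₀.ofLp + η ⬝ᵥ d + a ≤ s ∧
      ‖WithLp.toLp 2 (u.ofLp ᵥ* R - η ᵥ* C)‖ ≤ β := by
  constructor
  · intro h
    obtain ⟨η, hη, hnorm, hle⟩ := exists_multiplier hx₀ (WithLp.toLp 2 (u.ofLp ᵥ* R)) hβ
      (c := s - t - affineG qv R a u x₀) fun x hx => by
        have := h ⟨x, hx⟩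
        rw [dist_eq_norm] at this
        linarith [affineG_sub qv R a u x x₀]
    refine ⟨η, hη, ?_, hnorm⟩
    rw [dotProduct_sub, Matrix.dotProduct_mulVec, affineG] at hle
    rw [sub_dotProduct]
    linarith
  · rintro ⟨η, hη, hle, hnorm⟩ ⟨x, hx⟩
    -- Weak duality: Cauchy–Schwarz bounds the residual `uᵀR - ηᵀC`, and `η ≥ 0` with `C x ≤ d`
    -- bounds the rest.
    have h₁ := (real_inner_le_norm (WithLp.toLp 2 (u.ofLp ᵥ* R - η ᵥ* C)) (x - x₀)).trans
      (mul_le_mul_of_nonneg_right hnorm (norm_nonneg _))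
    have h₂ : η ⬝ᵥ (C *ᵥ x.ofLp) ≤ η ⬝ᵥ d := dotProduct_le_dotProduct_of_nonneg_left hx hη
    rw [Matrix.dotProduct_mulVec] at h₂
    rw [inner_toLp_eq_dotProduct, WithLp.ofLp_sub, dotProduct_sub, sub_dotProduct,
      sub_dotProduct] at h₁
    rw [sub_dotProduct] at hle
    rw [affineG, dist_eq_norm]
    linarith

/-- Measure duality supplies `t`, `β`, `s` for each `l`; then, with `β` and `s` fixed, polyhedral
duality supplies `η` for each `l` and `i`. -/
lemma mem_feasible_and_le_iff (hN : 0 < N) (hΞ : IsCompact (polyhedron C d))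
    (ξ : Fin N → polyhedron C d) {r ε : ℝ} (hr : 0 ≤ r) (hε : ε ∈ Set.Ioo (0 : ℝ) 1)
    (κ : EuclideanSpace ℝ (Fin (m + 1))) (qv : Fin M → EuclideanSpace ℝ (Fin (m + 1)))
    (R : Fin M → Matrix (Fin (m + 1)) (Fin k) ℝ) (a : Fin M → ℝ)
    (u : EuclideanSpace ℝ (Fin (m + 1))) (y : ℝ) :
    (u ∈ (cvarProgram 1 (polyhedron C d) ξ r ε κ fun l => affineG (qv l) (R l) (a l)).feasible ∧
      ‖u - κ‖ ^ 2 ≤ y) ↔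
    ∃ t s β η, (u, y, t, s, β, η) ∈
      (socp C d (fun i => (ξ i : EuclideanSpace ℝ (Fin k))) r ε κ qv R a).feasible := by
  have : CompactSpace (polyhedron C d) := isCompact_iff_compactSpace.1 hΞ
  have hdual := fun l => worstCaseCVaR_le_zero_iff hN (ξ := ξ) hr hε
    ((lipschitzWith_affineG (qv l) (R l) (a l) u).comp
      (LipschitzWith.subtype_val (polyhedron C d)))
  constructor
  · rintro ⟨⟨hu, hl⟩, hy⟩
    choose t β s hβ hbudget hs hslack using fun l => (hdual l).1 (hl l)
    choose η hη hle hnorm using fun l i =>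
      (forall_affineG_sub_dist_le_iff (ξ i).2 (qv l) (R l) (a l) u (hβ l)).1 (hslack l i)
    exact ⟨t, s, β, η, hu, hβ, hbudget, hs, hle, hnorm, hη, sqrt_epigraph_iff.2 hy⟩
  · rintro ⟨t, s, β, η, hu, hβ, hbudget, hs, hle, hnorm, hη, hy⟩
    refine ⟨⟨hu, fun l => (hdual l).2 ⟨t l, β l, s l, hβ l, hbudget l, hs l, fun i => ?_⟩⟩,
      sqrt_epigraph_iff.1 hy⟩
    exact (forall_affineG_sub_dist_le_iff (ξ i).2 (qv l) (R l) (a l) u (hβ l)).2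
      ⟨η l i, hη l i, hle l i, hnorm l i⟩

end Reformulation

end DRCCP

/-! ### From the epigraph projection to values and optimizers -/

theorem proposition2 {n m k N M q : ℕ} (hN : 0 < N)
    (C : Matrix (Fin q) (Fin k) ℝ) (d : Fin q → ℝ)
    (hΞ : IsCompact (DRCCP.polyhedron C d))
    (ξ : Fin N → DRCCP.polyhedron C d)
    (r ε : ℝ) (hr : 0 ≤ r) (hε : ε ∈ Set.Ioo (0 : ℝ) 1)
    (κ : EuclideanSpace ℝ (Fin n) → EuclideanSpace ℝ (Fin (m + 1)))
    (qv : Fin M → EuclideanSpace ℝ (Fin n) → EuclideanSpace ℝ (Fin (m + 1)))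
    (R : Fin M → EuclideanSpace ℝ (Fin n) → Matrix (Fin (m + 1)) (Fin k) ℝ)
    (α : Fin M → ℝ → ℝ) (J : Fin M → EuclideanSpace ℝ (Fin n) → ℝ)
    (x : EuclideanSpace ℝ (Fin n))
    (P : DRCCP.Program (EuclideanSpace ℝ (Fin (m + 1))))
    (hP : P = DRCCP.cvarProgram 1 (DRCCP.polyhedron C d) ξ r ε (κ x)
      (fun l => DRCCP.affineG (qv l x) (R l x) (α l (J l x))))
    (S : DRCCP.Program (DRCCP.Decision m N M q))
    (hS : S = DRCCP.socp C d (fun i => (ξ i : EuclideanSpace ℝ (Fin k))) r ε (κ x)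
      (fun l => qv l x) (fun l => R l x) (fun l => α l (J l x))) :
    -- the reformulation is a second-order cone program
    S.IsSOCP ∧
    -- its projection to `(u, y)` is the epigraph of the original objective on the feasible set
    (∀ u y, (u ∈ P.feasible ∧ P.objective u ≤ y) ↔
      ∃ t s β η, (u, y, t, s, β, η) ∈ S.feasible) ∧
    -- the feasible controls, the optimal values and the optimal controls agree
    (∀ u, u ∈ P.feasible ↔ ∃ y t s β η, (u, y, t, s, β, η) ∈ S.feasible) ∧
    P.value = S.value ∧
    (∀ u, P.IsOptimal u ↔ ∃ y t s β η, S.IsOptimal (u, y, t, s, β, η)) ∧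
    -- at an optimal solution of the reformulation, `y` is the original objective
    (∀ u y t s β η, S.IsOptimal (u, y, t, s, β, η) → y = P.objective u) := by
  have hproj : ∀ u y, (u ∈ P.feasible ∧ P.objective u ≤ y) ↔
      ∃ t s β η, (u, y, t, s, β, η) ∈ S.feasible := by
    intro u y
    rw [hP, hS]
    exact DRCCP.mem_feasible_and_le_iff hN hΞ ξ hr hε (κ x) (fun l => qv l x) (fun l => R l x)
      (fun l => α l (J l x)) u y
  have hobj : ∀ u y t s β η, S.objective (u, y, t, s, β, η) = y := by
    intros
    rw [hS]
    rfl
  have hbelow : ∀ u y t s β η, (u, y, t, s, β, η) ∈ S.feasible →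
      u ∈ P.feasible ∧ P.objective u ≤ y :=
    fun u y t s β η h => (hproj u y).2 ⟨t, s, β, η, h⟩
  have hlift : ∀ u, u ∈ P.feasible → ∃ t s β η, (u, P.objective u, t, s, β, η) ∈ S.feasible :=
    fun u hu => (hproj u _).1 ⟨hu, le_rfl⟩
  have hopt : ∀ u y t s β η, S.IsOptimal (u, y, t, s, β, η) → y = P.objective u := by
    rintro u y t s β η ⟨hmem, hle⟩
    obtain ⟨hu, huy⟩ := hbelow _ _ _ _ _ _ hmem
    obtain ⟨t', s', β', η', h'⟩ := hlift u hu
    have := hle _ h'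
    rw [hobj, hobj] at this
    exact le_antisymm this huy
  refine ⟨?_, hproj, fun u => ⟨fun hu => ⟨_, hlift u hu⟩, ?_⟩, le_antisymm ?_ ?_,
    fun u => ⟨?_, ?_⟩, hopt⟩
  · rw [hS]
    exact DRCCP.isSOCP_socp ..
  · rintro ⟨y, t, s, β, η, h⟩
    exact (hbelow _ _ _ _ _ _ h).1
  · refine le_iInf₂ fun ⟨u, y, t, s, β, η⟩ h => ?_
    obtain ⟨hu, huy⟩ := hbelow _ _ _ _ _ _ h
    refine (iInf₂_le u hu).trans ?_
    rw [hobj]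
    exact_mod_cast huy
  · refine le_iInf₂ fun u hu => ?_
    obtain ⟨t, s, β, η, h⟩ := hlift u hu
    refine (iInf₂_le _ h).trans ?_
    rw [hobj]
  · rintro ⟨hu, hle⟩
    obtain ⟨t, s, β, η, h⟩ := hlift u hu
    refine ⟨_, t, s, β, η, h, fun ⟨u', y', t', s', β', η'⟩ h' => ?_⟩
    obtain ⟨hu', huy'⟩ := hbelow _ _ _ _ _ _ h'
    rw [hobj, hobj]
    exact (hle u' hu').trans huy'
  · rintro ⟨y, t, s, β, η, h⟩
    have hy := hopt _ _ _ _ _ _ h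
    subst hy
    refine ⟨(hbelow _ _ _ _ _ _ h.1).1, fun u' hu' => ?_⟩
    obtain ⟨t', s', β', η', h'⟩ := hlift u' hu'
    have := h.2 _ h'
    rwa [hobj, hobj] at this
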